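/- Let $\Bbbk$ be an algebraically closed field of characteristic $0$, let $\mathfrak g$ be a finite-dimensional semisimple Lie algebra over $\Bbbk$ of rank $\operatorname{rk}\mathfrak g$, and let $e\in\mathfrak g$ be nilpotent, with centralizer $\mathfrak g^e$. For a finite-dimensional Lie algebra $\mathfrak a$, let $\operatorname{ind}\mathfrak a=\min_{\xi\in\mathfrak a^*}\dim\mathfrak a^{\xi}$ be its index, where $\mathfrak a^\xi$ is the stabilizer of $\xi$ in the coadjoint representation. Let $\mathfrak t\subset\mathfrak t_1\subset\mathfrak g^e$ be commutative subalgebras consisting of semisimple elements of $\mathfrak g$; let $\mathfrak l=\mathfrak z_{\mathfrak g}(\mathfrak t)$ be the centralizer of $\mathfrak t$ in $\mathfrak g$, and $\mathfrak l^e=\mathfrak l\cap\mathfrak g^e$. For $\lambda\in\mathfrak t_1^*$ let $\mathfrak g^e_\lambda=\{x\in\mathfrak g^e : [h,x]=\lambda(h)x\ \text{for all } h\in\mathfrak t_1\}$. Let $\lambda_1,\dots,\lambda_m\in\mathfrak t_1^*$ be pairwise different and such that the weights of $\mathfrak t_1$ in $\mathfrak g^e$ whose restriction to $\mathfrak t$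 is not identically zero are precisely the elements $\pm\lambda_i$. For $i=1,\dots,m$ let $v_{i,1},\dots,v_{i,m_i}$ and $w_{i,1},\dots,w_{i,m_i}$ be bases of $\mathfrak g^e_{\lambda_i}$ and $\mathfrak g^e_{-\lambda_i}$ respectively, and set $$q_i=\det\bigl([v_{i,k},w_{i,l}]\bigr)_{1\le k,l\le m_i}\in \mathrm S(\mathfrak l^e),$$ where $\mathrm S(\mathfrak l^e)$ is the symmetric algebra of $\mathfrak l^e$. Suppose that $\operatorname{ind}\mathfrak l^e=\operatorname{rk}\mathfrak g$ and that one of the following two conditions holds: 1. $q_i\neq0$ for $i=1,\dots,m$; 2. there is $j\in\{1,\dots,m\}$ such that $q_i\ne0$ for all $i\neq j$, and such that the bases $v_{j,1},\dots,v_{j,m_j}$ and $w_{j,1},\dots,w_{j,m_j}$ of $\mathfrak g^e_{\lambda_j}$ and $\mathfrak g^e_{-\lambda_j}$ can be chosen so that $$\det\bigl([v_{j,k},w_{j,l}]\bigr)_{1\le k,l\le m_j-1}\neq0$$ (the empty determinant being $1$). Then $\operatorname{ind}\mathfrak g^e=\operatorname{rk}\mathfrak g$. -/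

import Mathlib

namespace LieIndex

section Index

variable (k : Type*) {A : Type*} [Field k] [LieRing A] [LieAlgebra k A]

/-- The stabilizer `A^ξ = {x ∈ A | x · ξ = 0}` of a linear form `ξ` for the coadjoint
representation of the Lie algebra `A`. -/
def coadjointStabilizer (ξ : Module.Dual k A) : Submodule k A where
  carrier := {x | ⁅x, ξ⁆ = 0}
  add_mem' := by
    intro x y hx hy
    change ⁅x + y, ξ⁆ = 0
    rw [add_lie, show ⁅x, ξ⁆ = 0 from hx, show ⁅y, ξ⁆ = 0 from hy, add_zero]
  zero_mem' := by simp
  smul_mem' := by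
    intro c x hx
    change ⁅c • x, ξ⁆ = 0
    rw [smul_lie, show ⁅x, ξ⁆ = 0 from hx, smul_zero]

variable (A)

/-- The index of a (finite-dimensional) Lie algebra: the minimal dimension of the stabilizers of
linear forms for the coadjoint representation. The set of natural numbers is nonempty, so `sInf`
is its least element. -/
noncomputable def index : ℕ :=
  sInf (Set.range fun ξ : Module.Dual k A => Module.finrank k (coadjointStabilizer k ξ))

end Index

variable {k L : Type*} [Field k] [LieRing L] [LieAlgebra k L]

variable (k) in
/-- The centralizer of a subset `S` in the Lie algebra `L`, as a Lie subalgebra. -/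
def centralizer (S : Set L) : LieSubalgebra k L where
  carrier := {x | ∀ s ∈ S, ⁅x, s⁆ = 0}
  add_mem' := by
    intro x y hx hy s hs
    rw [add_lie, hx s hs, hy s hs, add_zero]
  zero_mem' := by simp
  smul_mem' := by
    intro c x hx s hs
    rw [smul_lie, hx s hs, smul_zero]
  lie_mem' := by
    intro x y hx hy s hs
    rw [lie_lie, hx s hs, hy s hs, lie_zero, lie_zero, sub_zero]

variable (k) in
/-- The centralizer `L^e` of an element `e` of `L`. -/
abbrev elementCentralizer (e : L) : LieSubalgebra k L := centralizer k {e}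

/-- The centralizer `𝔩^e` of `e` in `𝔩`, where `𝔩` is the centralizer of `t` in `L`. -/
abbrev leviCentralizer (e : L) (t : LieSubalgebra k L) : LieSubalgebra k L :=
  centralizer k (t : Set L) ⊓ elementCentralizer k e

/-- A commutative subalgebra consisting of semisimple elements of the (semisimple) Lie
algebra `L`. -/
structure IsTorus (t : LieSubalgebra k L) : Prop where
  commutative : ∀ x ∈ t, ∀ y ∈ t, ⁅x, y⁆ = 0
  semisimple : ∀ x ∈ t, (LieAlgebra.ad k L x).IsSemisimple

/-- The `χ`-weight space of the adjoint action of `t₁` in `L^e`. -/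
def weightSpace (e : L) (t₁ : LieSubalgebra k L) (χ : Module.Dual k t₁) : Submodule k L where
  carrier := {x | x ∈ elementCentralizer k e ∧ ∀ h : t₁, ⁅(h : L), x⁆ = χ h • x}
  add_mem' := by
    rintro x y ⟨hx, hx'⟩ ⟨hy, hy'⟩
    refine ⟨add_mem hx hy, fun h => ?_⟩
    rw [lie_add, hx' h, hy' h, smul_add]
  zero_mem' := ⟨zero_mem _, by simp⟩
  smul_mem' := by
    rintro c x ⟨hx, hx'⟩
    refine ⟨(elementCentralizer k e).smul_mem c hx, fun h => ?_⟩
    rw [lie_smul, hx' h, smul_comm]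

/-- `χ` is a weight of the adjoint action of `t₁` in `L^e` which is not identically zero on
`t`. -/
def IsWeightNonzeroOn (e : L) (t t₁ : LieSubalgebra k L) (χ : Module.Dual k t₁) : Prop :=
  weightSpace e t₁ χ ≠ ⊥ ∧ ∃ h : t₁, (h : L) ∈ t ∧ χ h ≠ 0

theorem lie_mem_leviCentralizer {e : L} {t t₁ : LieSubalgebra k L} (htt₁ : t ≤ t₁)
    {χ : Module.Dual k t₁} {x y : L} (hx : x ∈ weightSpace e t₁ χ)
    (hy : y ∈ weightSpace e t₁ (-χ)) : ⁅x, y⁆ ∈ leviCentralizer e t := by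
  refine (LieSubalgebra.mem_inf _ _ _).2 ⟨fun s hs => ?_, (elementCentralizer k e).lie_mem hx.1 hy.1⟩
  have h1 := hx.2 ⟨s, htt₁ hs⟩
  have h2 := hy.2 ⟨s, htt₁ hs⟩
  simp only [LinearMap.neg_apply] at h1 h2
  rw [← lie_skew, leibniz_lie, h1, h2]
  simp

/-- The bracket of opposite weight vectors, as an element of `𝔩^e`. -/
def oppositeBracket {e : L} {t t₁ : LieSubalgebra k L} (htt₁ : t ≤ t₁) {χ : Module.Dual k t₁}
    (x : weightSpace e t₁ χ) (y : weightSpace e t₁ (-χ)) : leviCentralizer e t :=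
  ⟨⁅(x : L), (y : L)⁆, lie_mem_leviCentralizer htt₁ x.2 y.2⟩

/-- The determinant `det ([v_a, w_b])_{a, b < n}`, an element of the symmetric algebra
`S(𝔩^e)`. -/
noncomputable def bracketDet {e : L} {t t₁ : LieSubalgebra k L} (htt₁ : t ≤ t₁)
    {χ : Module.Dual k t₁} {n : ℕ} (v : Fin n → weightSpace e t₁ χ)
    (w : Fin n → weightSpace e t₁ (-χ)) : SymmetricAlgebra k (leviCentralizer e t) :=
  (Matrix.of fun a b => SymmetricAlgebra.ι k _ (oppositeBracket htt₁ (v a) (w b))).det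

end LieIndex

/-! Two inequalities are proved, each by moving along a line of linear forms or of elements and
using that the kernel of `f + s • g` is smallest for all but finitely many `s`.

Lower bound (Vinberg). Every element of `L` has centralizer of dimension at least the rank: this is
clear for regular elements and passes to all others by semicontinuity. A form `ξ` on `L^e` is
represented by some `y` through the Killing form. For almost all `s` the centralizer of `e + s • y`
has dimension at most that of `{v ∈ L^e | ⁅y, v⁆ ∈ im (ad e)}`, and by invariance this space lies in
the stabilizer of `ξ`.

Upper bound. Write `L^e = 𝔩^e ⊕ V`, where `V` is the sum of the weight spaces whose weight is
nonzero on `t`. For a form vanishing on `V` the Kirillov form is block diagonal. A generic such form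
has kernel of dimension at most `ind 𝔩^e` on `𝔩^e`. The `q_i`, evaluated at a form, are the
determinants of the pairings between opposite weight spaces, so the hypothesis bounds the kernel on
`V` by 2 (`index_le_of_isCompl`, `exists_generic_form`). If this second kernel is nonzero, the
stabilizer contains both `t` and a vector of `V` not commuting with `t`; a noncommutative stabilizer
exceeds the index by at least 2 (`index_add_two_le`), which absorbs the defect. -/

namespace LieIndex

open Module

/-! ### Kernels in pencils of linear maps -/

section Pencil

variable {k M N : Type*} [Field k] [AddCommGroup M] [Module k M] [FiniteDimensional k M]
  [AddCommGroup N] [Module k N]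

/-- If one member of a pencil of linear maps is injective, then all but finitely many are. -/
theorem finite_setOf_not_injective (f g : M →ₗ[k] N) (s₀ : k)
    (h : Function.Injective (f + s₀ • g)) :
    {s : k | ¬ Function.Injective (f + s • g)}.Finite := by
  obtain ⟨p, hp⟩ := LinearMap.exists_leftInverse_of_injective _ (LinearMap.ker_eq_bot.2 h)
  -- Applying `p` to `f x = -s • g x` gives `(s₀ - s) • p (g x) = x`, so `(s₀ - s)⁻¹` is one of the
  -- finitely many eigenvalues of `p ∘ g`.
  refine ((Module.End.finite_hasEigenvalue (p ∘ₗ g)).image fun μ => s₀ - μ⁻¹).subset fun s hs => ?_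
  have hs' : LinearMap.ker (f + s • g) ≠ ⊥ := fun h0 => hs (LinearMap.ker_eq_bot.1 h0)
  obtain ⟨x, hx, hx0⟩ := Submodule.exists_mem_ne_zero_of_ne_bot hs'
  have hpx : p (f x) + s₀ • p (g x) = x := by simpa using LinearMap.congr_fun hp x
  have hfx : f x = -(s • g x) := by simpa [add_eq_zero_iff_eq_neg] using hx
  have key : (s₀ - s) • p (g x) = x := by
    rw [hfx] at hpx
    conv_rhs => rw [← hpx]
    simp [sub_smul]
    abel
  have hne : s₀ - s ≠ 0 := by
    rintro h0
    rw [h0, zero_smul] at key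
    exact hx0 key.symm
  refine ⟨(s₀ - s)⁻¹, ?_, by simp⟩
  refine Module.End.hasEigenvalue_of_hasEigenvector (x := x) ⟨?_, hx0⟩
  rw [Module.End.mem_eigenspace_iff]
  change p (g x) = _
  conv_rhs => rw [← key]
  rw [smul_smul, inv_mul_cancel₀ hne, one_smul]

/-- The dimension of the kernel is generically minimal on a pencil of linear maps. -/
theorem finite_setOf_lt_finrank_ker (f g : M →ₗ[k] N) (s₀ : k) (d : ℕ)
    (h : finrank k (LinearMap.ker (f + s₀ • g)) ≤ d) :
    {s : k | d < finrank k (LinearMap.ker (f + s • g))}.Finite := by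
  obtain ⟨C, hC⟩ := Submodule.exists_isCompl (LinearMap.ker (f + s₀ • g))
  have hinj : Function.Injective (f ∘ₗ C.subtype + s₀ • (g ∘ₗ C.subtype)) := by
    rw [← LinearMap.ker_eq_bot, LinearMap.ker_eq_bot']
    intro x hx
    exact Subtype.ext ((Submodule.disjoint_def.1 hC.disjoint) x (by simpa using hx) x.2)
  refine (finite_setOf_not_injective _ _ s₀ hinj).subset fun s hs hs' => ?_
  have hdis : Disjoint (LinearMap.ker (f + s • g)) C := by
    rw [Submodule.disjoint_def]
    intro x hx hxC
    have := @hs' ⟨x, hxC⟩ 0 (by simpa using hx)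
    simpa using this
  have h1 := Submodule.finrank_add_finrank_le_of_disjoint hdis
  have h2 := Submodule.finrank_add_eq_of_isCompl hC
  have h3 : d < finrank k (LinearMap.ker (f + s • g)) := hs
  omega

/-- First order perturbation: for almost all `s`, the kernel of `f + s g` is at most as large as
the space of vectors of `ker f` that `g` maps into the range of `f`. -/
theorem finite_setOf_finrank_lt_finrank_ker (f g : M →ₗ[k] N) :
    {s : k | finrank k ↥(LinearMap.ker f ⊓ (LinearMap.range f).comap g) <
      finrank k (LinearMap.ker (f + s • g))}.Finite := by
  set S := LinearMap.ker f ⊓ (LinearMap.range f).comap g with hS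
  obtain ⟨C, hC⟩ := Submodule.exists_isCompl (LinearMap.ker f)
  obtain ⟨E, hE⟩ := Submodule.exists_isCompl S
  set E' := LinearMap.ker f ⊓ E with hE'
  have hdimE : finrank k (LinearMap.ker f) ≤ finrank k S + finrank k E' := by
    rw [← Submodule.finrank_sup_add_finrank_inf_eq S E']
    refine (Submodule.finrank_mono ?_).trans (Nat.le_add_right _ _)
    intro x hx
    obtain ⟨y, hy, z, hz, rfl⟩ := Submodule.mem_sup.1 (hE.sup_eq_top.symm ▸ Submodule.mem_top (x := x))
    refine Submodule.add_mem_sup hy ⟨?_, hz⟩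
    simpa using sub_mem hx hy.1
  have hCE : Disjoint C E' := hC.disjoint.symm.mono_right inf_le_left
  -- Dividing the image of `E'` by `s` gives a pencil with a limit at `s = 0`: for `y ∈ E' ⊆ ker f`,
  -- `(f + s • g) (c + y) = (F + s • G) (c, s • y)`. The limit `F` is injective because `g x ∈ range
  -- f` with `x ∈ E'` forces `x ∈ S ⊓ E`.
  let F : (C × E') →ₗ[k] N := (f ∘ₗ C.subtype).coprod (g ∘ₗ E'.subtype)
  let G : (C × E') →ₗ[k] N := (g ∘ₗ C.subtype).coprod 0
  have hinj : Function.Injective (F + (0 : k) • G) := by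
    rw [zero_smul, add_zero, ← LinearMap.ker_eq_bot, LinearMap.ker_eq_bot']
    rintro ⟨c, x⟩ hcx
    have hcx' : f c + g x = 0 := by simpa [F] using hcx
    have hx : (x : M) = 0 := by
      refine (Submodule.disjoint_def.1 hE.disjoint) x ⟨x.2.1, ?_⟩ x.2.2
      exact ⟨-c, by rw [map_neg]; exact (neg_eq_of_add_eq_zero_right hcx')⟩
    have hc : (c : M) = 0 := by
      refine (Submodule.disjoint_def.1 hC.disjoint) c ?_ c.2
      simpa [hx] using hcx'
    ext <;> simp [hx, hc]
  refine ((finite_setOf_not_injective F G 0 hinj).union (Set.finite_singleton 0)).subset ?_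
  intro s hs
  by_contra hcon
  simp only [Set.mem_union, Set.mem_ofPred_eq, Set.mem_singleton_iff, not_or, not_not] at hcon
  obtain ⟨hs', hs0⟩ := hcon
  have hdis : Disjoint (LinearMap.ker (f + s • g)) (C ⊔ E') := by
    rw [Submodule.disjoint_def]
    intro x hx hxC
    obtain ⟨c, hc, y, hy, rfl⟩ := Submodule.mem_sup.1 hxC
    have hfy : f y = 0 := hy.1
    have hx' : f c + s • (g c + g y) = 0 := by simpa [hfy] using hx
    have := @hs' (⟨c, hc⟩, s • ⟨y, hy⟩) 0 (by
      simp [F, G]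
      rw [← hx', smul_add]; abel)
    simp only [Prod.mk_eq_zero, smul_eq_zero, hs0, false_or] at this
    have h1 : c = 0 := by simpa using this.1
    have h2 : y = 0 := by simpa using this.2
    simp [h1, h2]
  have h1 := Submodule.finrank_add_finrank_le_of_disjoint hdis
  have h2 := Submodule.finrank_add_eq_of_isCompl hC
  have h3 : finrank k S < finrank k (LinearMap.ker (f + s • g)) := hs
  have h4 := Submodule.finrank_sup_add_finrank_inf_eq C E'
  rw [hCE.eq_bot, finrank_bot] at h4
  omega

end Pencil

/-! ### Vinberg's inequality -/

section Vinberg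

variable {k L : Type*} [Field k] [LieRing L] [LieAlgebra k L] [FiniteDimensional k L]

/-- The Engel subalgebra of a regular element is a Cartan subalgebra. -/
theorem isCartanSubalgebra_engel_of_isRegular [Infinite k] {x : L}
    (hx : LieAlgebra.IsRegular k x) : (LieSubalgebra.engel k x).IsCartanSubalgebra := by
  refine ⟨?_, LieSubalgebra.normalizer_engel _ _⟩
  apply LieSubalgebra.isNilpotent_of_forall_le_engel
  intro y hy
  -- By Engel's theorem it suffices that this Engel subalgebra lies in that of each of its elements;
  -- this follows from minimality, its dimension being the rank, the least possible.
  set Ex : {LieSubalgebra.engel k z | z ∈ LieSubalgebra.engel k x} :=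
    ⟨LieSubalgebra.engel k x, x, LieSubalgebra.self_mem_engel _ _, rfl⟩
  suffices IsBot Ex from @this ⟨LieSubalgebra.engel k y, y, hy, rfl⟩
  have hcard : (finrank k L : Cardinal) ≤ Cardinal.mk k :=
    Cardinal.natCast_le_aleph0.trans <| Cardinal.infinite_iff.mp ‹Infinite k›
  rw [← Cardinal.lift_id (Cardinal.mk k)] at hcard
  apply LieAlgebra.engel_isBot_of_isMin (by simpa using hcard) (LieSubalgebra.engel k x) Ex le_rfl
  rintro ⟨_, y, hy, rfl⟩ hyx
  suffices finrank k (LieSubalgebra.engel k x) ≤ finrank k (LieSubalgebra.engel k y) by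
    suffices LieSubalgebra.engel k y = LieSubalgebra.engel k x from this.ge
    apply LieSubalgebra.toSubmodule_injective
    exact Submodule.eq_of_le_of_finrank_le hyx this
  rw [(LieAlgebra.isRegular_iff_finrank_engel_eq_rank k x).mp hx]
  apply LieAlgebra.rank_le_finrank_engel

attribute [local instance 100] LieRing.ofAssociativeRing in
/-- A line through a regular element consists of regular elements, with finitely many
exceptions. -/
theorem finite_setOf_not_isRegular {x y : L} (s₀ : k)
    (h : LieAlgebra.IsRegular k (x + s₀ • y)) :
    {s : k | ¬ LieAlgebra.IsRegular k (x + s • y)}.Finite := by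
  classical
  let b := finBasis k L
  -- Regularity is the nonvanishing of one coefficient of the characteristic polynomial of `ad`; `P`
  -- is this coefficient along the line.
  let P : Polynomial k := MvPolynomial.aeval
    (fun i => Polynomial.C (b.repr x i) + Polynomial.C (b.repr y i) * Polynomial.X)
    ((LinearMap.polyCharpoly (LieAlgebra.ad k L).toLinearMap b).coeff (LieAlgebra.rank k L))
  have hP : ∀ s, P.eval s = MvPolynomial.eval (b.repr (x + s • y))
      ((LinearMap.polyCharpoly (LieAlgebra.ad k L).toLinearMap b).coeff
        (LieAlgebra.rank k L)) := by
    intro s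
    have hb : (fun i => Polynomial.aeval s (Polynomial.C (b.repr x i) +
        Polynomial.C (b.repr y i) * Polynomial.X)) = b.repr (x + s • y) := by
      funext i
      simp only [map_add, map_mul, Polynomial.aeval_C, Polynomial.aeval_X, map_smul,
        Finsupp.add_apply, Finsupp.smul_apply, smul_eq_mul, Algebra.algebraMap_self,
        RingHom.id_apply, mul_comm s]
    rw [← Polynomial.coe_evalRingHom, ← Polynomial.coe_aeval_eq_evalRingHom]
    change Polynomial.aeval s (MvPolynomial.aeval _ _) = _
    rw [← AlgHom.comp_apply, MvPolynomial.comp_aeval, hb, MvPolynomial.aeval_eq_eval]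
  have hreg : ∀ s, LieAlgebra.IsRegular k (x + s • y) ↔ P.eval s ≠ 0 := fun s => by
    rw [hP, LieAlgebra.isRegular_iff_coeff_polyCharpoly_rank_ne_zero k b]
  have hP0 : P ≠ 0 := by
    rintro h0
    exact (hreg s₀).1 h (by simp [h0])
  refine (P.roots.toFinset.finite_toSet).subset fun s hs => ?_
  have hs' : ¬ LieAlgebra.IsRegular k (x + s • y) := hs
  rw [hreg, not_not] at hs'
  simpa [hP0] using hs'

theorem mem_coadjointStabilizer {A : Type*} [LieRing A] [LieAlgebra k A] {ξ : Dual k A} {x : A} :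
    x ∈ coadjointStabilizer k ξ ↔ ∀ y, ξ ⁅x, y⁆ = 0 := by
  change ⁅x, ξ⁆ = 0 ↔ _
  rw [LinearMap.ext_iff]
  simp

variable [CharZero k] [LieAlgebra.IsSemisimple k L]

/-- In a semisimple Lie algebra all centralizers have dimension at least the rank. -/
theorem rank_le_finrank_ker_ad (z : L) :
    LieAlgebra.rank k L ≤ finrank k (LinearMap.ker (LieAlgebra.ad k L z)) := by
  -- For regular `x` the Engel subalgebra is a Cartan subalgebra, hence abelian, so it centralizes
  -- `x`.
  have hreg : ∀ x : L, LieAlgebra.IsRegular k x →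
      LieAlgebra.rank k L ≤ finrank k (LinearMap.ker (LieAlgebra.ad k L x)) := by
    intro x hx
    have := isCartanSubalgebra_engel_of_isRegular hx
    rw [← (LieAlgebra.isRegular_iff_finrank_engel_eq_rank k x).mp hx]
    refine Submodule.finrank_mono fun y hy => ?_
    have := LieModule.IsTrivial.trivial (⟨x, LieSubalgebra.self_mem_engel k x⟩ : LieSubalgebra.engel k x)
      (⟨y, hy⟩ : LieSubalgebra.engel k x)
    exact congrArg Subtype.val this
  obtain ⟨x₀, hx₀⟩ := LieAlgebra.exists_isRegular k L
  by_contra! hlt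
  -- The line runs from `z` at `s = 0` to the regular element `x₀` at `s = 1`.
  have h1 := finite_setOf_not_isRegular (x := z) (y := x₀ - z) (1 : k) (by simpa using hx₀)
  have h2 := finite_setOf_lt_finrank_ker (LieAlgebra.ad k L z) (LieAlgebra.ad k L (x₀ - z)) 0
    (finrank k (LinearMap.ker (LieAlgebra.ad k L z))) (by rw [zero_smul, add_zero])
  obtain ⟨s, hs⟩ := (h1.union h2).infinite_compl.nonempty
  simp only [Set.mem_compl_iff, Set.mem_union, Set.mem_ofPred_eq, not_or, not_not, not_lt] at hs
  have h3 := hreg _ hs.1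
  rw [map_add, map_smul] at h3
  omega

/-- **Vinberg's inequality**: the index of the centralizer of an element of a semisimple Lie
algebra is at least the rank. -/
theorem rank_le_index_elementCentralizer (e : L) :
    LieAlgebra.rank k L ≤ index k (elementCentralizer k e) := by
  refine le_csInf (Set.range_nonempty _) ?_
  rintro _ ⟨ξ, rfl⟩
  obtain ⟨ξ', hξ'⟩ := LinearMap.exists_extend (p := (elementCentralizer k e).toSubmodule) ξ
  obtain ⟨y, hy⟩ := (killingForm k L).toDual (LieAlgebra.IsKilling.killingForm_nondegenerate k L)
    |>.surjective ξ'
  have hyξ : ∀ a : elementCentralizer k e, killingForm k L y a = ξ a := by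
    intro a
    rw [← LinearMap.congr_fun hξ' a, ← hy]
    rfl
  obtain ⟨s, hs⟩ := (finite_setOf_finrank_lt_finrank_ker (LieAlgebra.ad k L e)
    (LieAlgebra.ad k L y)).infinite_compl.nonempty
  simp only [Set.mem_compl_iff, Set.mem_ofPred_eq, not_lt] at hs
  rw [← map_smul, ← map_add] at hs
  refine (rank_le_finrank_ker_ad (e + s • y)).trans (hs.trans ?_)
  refine le_trans (Submodule.finrank_mono ?_) (Submodule.finrank_map_le
    (elementCentralizer k e).incl.toLinearMap (coadjointStabilizer k ξ))
  rintro v ⟨hv, z, hz⟩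
  have hve : v ∈ elementCentralizer k e := by
    rintro _ rfl
    rw [← lie_skew, neg_eq_zero]
    exact hv
  refine ⟨⟨v, hve⟩, mem_coadjointStabilizer.2 fun u => ?_, rfl⟩
  -- With `⁅y, v⁆ = ⁅e, z⁆`, invariance turns `ξ ⁅v, u⁆` into `κ(⁅e, z⁆, u) = -κ(z, ⁅e, u⁆)`, which
  -- is zero as `u` commutes with `e`.
  rw [← hyξ]
  change killingForm k L y ⁅v, (u : L)⁆ = 0
  rw [← LieModule.traceForm_apply_lie_apply]
  change ⁅e, z⁆ = ⁅y, v⁆ at hz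
  rw [← hz, ← lie_skew, map_neg, LinearMap.neg_apply, LieModule.traceForm_apply_lie_apply,
    ← lie_skew, u.2 e rfl]
  simp

end Vinberg

/-! ### Kirillov forms and upper bounds for the index -/

section Kirillov

variable {k A : Type*} [Field k] [LieRing A] [LieAlgebra k A]

attribute [local instance 100] LieRing.ofAssociativeRing in
/-- The Kirillov form `(x, y) ↦ ξ ⁅x, y⁆`, depending linearly on `ξ`. -/
noncomputable def kirillovForm : Dual k A →ₗ[k] A →ₗ[k] Dual k A where
  toFun ξ := (LieModule.toEnd k A A).toLinearMap.compr₂ ξ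
  map_add' ξ η := by ext; simp
  map_smul' c ξ := by ext; simp

@[simp] theorem kirillovForm_apply (ξ : Dual k A) (x y : A) : kirillovForm ξ x y = ξ ⁅x, y⁆ := rfl

theorem ker_kirillovForm (ξ : Dual k A) :
    LinearMap.ker (kirillovForm ξ) = coadjointStabilizer k ξ := by
  ext x
  rw [mem_coadjointStabilizer, LinearMap.mem_ker, LinearMap.ext_iff]
  rfl

/-- The restriction of the Kirillov form to a subspace. -/
noncomputable def kirillovFormOn (U : Submodule k A) (ξ : Dual k A) : U →ₗ[k] Dual k U :=
  U.dualRestrict ∘ₗ kirillovForm ξ ∘ₗ U.subtype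

@[simp] theorem kirillovFormOn_apply (U : Submodule k A) (ξ : Dual k A) (x y : U) :
    kirillovFormOn U ξ x y = ξ ⁅(x : A), (y : A)⁆ := rfl

theorem kirillovFormOn_add_smul (U : Submodule k A) (ξ η : Dual k A) (s : k) :
    kirillovFormOn U (ξ + s • η) = kirillovFormOn U ξ + s • kirillovFormOn U η := by
  ext; simp

theorem index_le_finrank_ker (ξ : Dual k A) :
    index k A ≤ finrank k (LinearMap.ker (kirillovForm ξ)) := by
  rw [ker_kirillovForm]
  exact Nat.sInf_le ⟨ξ, rfl⟩

variable [FiniteDimensional k A]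

/-- If the stabilizer of `ξ` is not commutative, then the index is smaller than its dimension,
by at least two. -/
theorem index_add_two_le [Infinite k] (ξ : Dual k A) {h a : A}
    (hh : h ∈ LinearMap.ker (kirillovForm ξ)) (ha : a ∈ LinearMap.ker (kirillovForm ξ))
    (hne : ⁅h, a⁆ ≠ 0) : index k A + 2 ≤ finrank k (LinearMap.ker (kirillovForm ξ)) := by
  obtain ⟨η, hη⟩ : ∃ η : Dual k A, η ⁅h, a⁆ ≠ 0 := by
    by_contra! hcon
    exact hne ((Module.forall_dual_apply_eq_zero_iff k _).1 hcon)
  obtain ⟨s, hs⟩ := (finite_setOf_finrank_lt_finrank_ker (kirillovForm ξ)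
    (kirillovForm η)).infinite_compl.nonempty
  simp only [Set.mem_compl_iff, Set.mem_ofPred_eq, not_lt] at hs
  rw [← map_smul, ← map_add] at hs
  set K := LinearMap.ker (kirillovForm ξ) with hK
  set S := K ⊓ (LinearMap.range (kirillovForm ξ)).comap (kirillovForm η) with hS
  -- `S` lies in the radical of the form `η ⁅·, ·⁆` on `K`. This form is nonzero on the pair `h, a`,
  -- so their span is a plane meeting `S` trivially.
  have hSK : ∀ v ∈ S, ∀ u ∈ K, η ⁅v, u⁆ = 0 := by
    rintro v ⟨hv, z, hz⟩ u hu
    have h1 := LinearMap.congr_fun hz u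
    have h2 := LinearMap.congr_fun hu z
    simp only [kirillovForm_apply, LinearMap.zero_apply] at h1 h2
    rw [← h1, ← lie_skew, map_neg, h2, neg_zero]
  let j : k × k →ₗ[k] A := (LinearMap.toSpanSingleton k A h).coprod (LinearMap.toSpanSingleton k A a)
  have hj : ∀ c, j c ∈ S → c = 0 := by
    rintro ⟨c, d⟩ hcd
    have h1 := hSK _ hcd _ ha
    have h2 := hSK _ hcd _ hh
    have hη' : η ⁅a, h⁆ ≠ 0 := by rwa [← lie_skew, map_neg, neg_ne_zero]
    simp [j, hη, hη'] at h1 h2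
    simp [h1, h2]
  have hdis : Disjoint S (LinearMap.range j) := by
    rw [Submodule.disjoint_def]
    rintro _ hx ⟨c, rfl⟩
    rw [hj c hx, map_zero]
  have hjinj : Function.Injective j := by
    rw [← LinearMap.ker_eq_bot, LinearMap.ker_eq_bot']
    intro c hc
    exact hj c (hc ▸ zero_mem S)
  have h1 := LinearMap.finrank_range_of_inj hjinj
  rw [Module.finrank_prod, Module.finrank_self] at h1
  have h2 := Submodule.finrank_sup_add_finrank_inf_eq S (LinearMap.range j)
  rw [hdis.eq_bot, finrank_bot] at h2
  have h3 : finrank k ↥(S ⊔ LinearMap.range j) ≤ finrank k K := by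
    refine Submodule.finrank_mono (sup_le inf_le_left ?_)
    rintro _ ⟨⟨c, d⟩, rfl⟩
    simpa [j] using add_mem (K.smul_mem c hh) (K.smul_mem d ha)
  have h4 := index_le_finrank_ker (ξ + s • η)
  omega

/-- Upper bound for the index of a Lie algebra `A = L₀ ⊕ V` with `⁅L₀, V⁆ ⊆ V`, in terms of
linear forms on `L₀`. -/
theorem index_le_of_isCompl [Infinite k] {L₀ V : Submodule k A} (hc : IsCompl L₀ V)
    (hLV : ∀ x ∈ L₀, ∀ y ∈ V, ⁅x, y⁆ ∈ V)
    (hT : ∀ a ∈ V, a ≠ 0 → ∃ h : A, (∀ y, ⁅h, y⁆ ∈ V) ∧ ⁅h, a⁆ ≠ 0)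
    {ξ₁ ξ₂ : Dual k A} (h₁ : ∀ x ∈ V, ξ₁ x = 0) (h₂ : ∀ x ∈ V, ξ₂ x = 0) {d : ℕ}
    (hd : finrank k (LinearMap.ker (kirillovFormOn L₀ ξ₂)) ≤ d)
    (hV : finrank k (LinearMap.ker (kirillovFormOn V ξ₁)) ≤ 2) : index k A ≤ d := by
  -- On the line through `ξ₁` (at `s = 0`) and `ξ₂` (at `s = 1`), almost every form satisfies both
  -- kernel bounds.
  have e1 := finite_setOf_lt_finrank_ker (kirillovFormOn L₀ ξ₁) (kirillovFormOn L₀ (ξ₂ - ξ₁)) 1 d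
    (by rw [← kirillovFormOn_add_smul, one_smul, add_sub_cancel]; exact hd)
  have e2 := finite_setOf_lt_finrank_ker (kirillovFormOn V ξ₁) (kirillovFormOn V (ξ₂ - ξ₁)) 0 2
    (by rw [← kirillovFormOn_add_smul, zero_smul, add_zero]; exact hV)
  obtain ⟨s, hs⟩ := (e1.union e2).infinite_compl.nonempty
  simp only [Set.mem_compl_iff, Set.mem_union, Set.mem_ofPred_eq, not_or, not_lt] at hs
  rw [← kirillovFormOn_add_smul, ← kirillovFormOn_add_smul] at hs
  set ξ := ξ₁ + s • (ξ₂ - ξ₁)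
  have hξV : ∀ x ∈ V, ξ x = 0 := fun x hx => by simp [ξ, h₁ x hx, h₂ x hx]
  have hVL : ∀ x ∈ V, ∀ y ∈ L₀, ⁅x, y⁆ ∈ V := fun x hx y hy => by
    rw [← lie_skew]; exact neg_mem (hLV y hy x hx)
  have hdec : ∀ x : A, ∃ y ∈ L₀, ∃ z ∈ V, y + z = x := fun x =>
    Submodule.mem_sup.1 (hc.sup_eq_top ▸ Submodule.mem_top)
  have hle : LinearMap.ker (kirillovForm ξ) ≤
      (LinearMap.ker (kirillovFormOn L₀ ξ)).map L₀.subtype ⊔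
        (LinearMap.ker (kirillovFormOn V ξ)).map V.subtype := by
    intro x hx
    have hx' : ∀ u, ξ ⁅x, u⁆ = 0 := fun u => LinearMap.congr_fun hx u
    obtain ⟨y, hy, z, hz, rfl⟩ := hdec x
    refine Submodule.add_mem_sup ⟨⟨y, hy⟩, ?_, rfl⟩ ⟨⟨z, hz⟩, ?_, rfl⟩
    · refine LinearMap.ext fun u => ?_
      have := hx' u
      rwa [add_lie, map_add, hξV _ (hVL z hz u u.2), add_zero] at this
    · refine LinearMap.ext fun u => ?_
      have := hx' u
      rwa [add_lie, map_add, hξV _ (hLV y hy u u.2), zero_add] at this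
  have hdim : finrank k (LinearMap.ker (kirillovForm ξ)) ≤
      finrank k (LinearMap.ker (kirillovFormOn L₀ ξ)) +
        finrank k (LinearMap.ker (kirillovFormOn V ξ)) := by
    refine (Submodule.finrank_mono hle).trans ((Submodule.finrank_add_le_finrank_add_finrank _ _).trans ?_)
    exact add_le_add (Submodule.finrank_map_le _ _) (Submodule.finrank_map_le _ _)
  -- Either the block on `V` is nondegenerate, or the stabilizer is noncommutative and the excess of
  -- at most 2 is recovered from `index_add_two_le`.
  by_cases hbot : LinearMap.ker (kirillovFormOn V ξ) = ⊥
  · rw [hbot, finrank_bot] at hdim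
    have := index_le_finrank_ker ξ
    omega
  obtain ⟨a, ha, ha0⟩ := Submodule.exists_mem_ne_zero_of_ne_bot hbot
  obtain ⟨h, hh, hha⟩ := hT a a.2 (by simpa using ha0)
  have hmem : h ∈ LinearMap.ker (kirillovForm ξ) := LinearMap.ext fun u => hξV _ (hh u)
  have hamem : (a : A) ∈ LinearMap.ker (kirillovForm ξ) := by
    refine LinearMap.ext fun u => ?_
    obtain ⟨y, hy, z, hz, rfl⟩ := hdec u
    have := LinearMap.congr_fun ha ⟨z, hz⟩
    simp only [kirillovFormOn_apply, LinearMap.zero_apply] at this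
    simp [hξV _ (hVL a a.2 y hy), this]
  have := index_add_two_le ξ hmem hamem hha
  omega

end Kirillov

/-! ### Evaluating determinants at linear forms -/

section Determinant

/-- A nonzero element of the symmetric algebra does not vanish at some linear form. -/
theorem exists_lift_ne_zero {k M : Type*} [Field k] [Infinite k] [AddCommGroup M] [Module k M]
    [FiniteDimensional k M] {q : SymmetricAlgebra k M} (hq : q ≠ 0) :
    ∃ ζ : Dual k M, SymmetricAlgebra.lift ζ q ≠ 0 := by
  let b := finBasis k M
  let E := SymmetricAlgebra.equivMvPolynomial b
  have hE : E q ≠ 0 := by simpa using hq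
  obtain ⟨x, hx⟩ : ∃ x, MvPolynomial.eval x (E q) ≠ 0 := by
    by_contra! hcon
    exact hE (MvPolynomial.funext fun x => by rw [hcon x, map_zero])
  refine ⟨b.constr k x, ?_⟩
  have hcomp : SymmetricAlgebra.lift (b.constr k x) = (MvPolynomial.aeval x).comp E.toAlgHom := by
    refine SymmetricAlgebra.algHom_ext (b.ext fun i => ?_)
    simp [E]
  rw [hcomp]
  simpa [MvPolynomial.aeval_eq_eval] using hx

variable {k M N : Type*} [Field k] [AddCommGroup M] [Module k M] [AddCommGroup N] [Module k N]
  {n : ℕ}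

theorem eq_zero_of_det_ne_zero_left (B : M →ₗ[k] N →ₗ[k] k) {v : Fin n → M} {w : Fin n → N}
    (hdet : (Matrix.of fun a b => B (v a) (w b)).det ≠ 0) {x : M}
    (hx : x ∈ Submodule.span k (Set.range v)) (hB : ∀ b, B x (w b) = 0) : x = 0 := by
  obtain ⟨c, rfl⟩ := (Submodule.mem_span_range_iff_exists_fun k).1 hx
  have hc : c = 0 := by
    refine Matrix.eq_zero_of_vecMul_eq_zero hdet (funext fun b => ?_)
    simpa [Matrix.vecMul, dotProduct] using hB b
  simp [hc]

theorem eq_zero_of_det_ne_zero_right (B : M →ₗ[k] N →ₗ[k] k) {v : Fin n → M} {w : Fin n → N}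
    (hdet : (Matrix.of fun a b => B (v a) (w b)).det ≠ 0) {y : N}
    (hy : y ∈ Submodule.span k (Set.range w)) (hB : ∀ a, B (v a) y = 0) : y = 0 := by
  refine eq_zero_of_det_ne_zero_left B.flip (v := w) (w := v) ?_ hy hB
  rw [← Matrix.det_transpose]
  exact hdet

/-- The span of all but the last vector of a finite basis contains the kernel of a linear form. -/
theorem exists_dual_mem_span_castLE (b : Basis (Fin n) k M) :
    ∃ α : Dual k M, ∀ x, α x = 0 →
      x ∈ Submodule.span k (Set.range fun a : Fin (n - 1) => b (Fin.castLE (Nat.sub_le _ _) a)) := by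
  -- For `n = 0` the truncated `n - 1` is `0` and the space is zero, so any form serves.
  cases n with
  | zero => exact ⟨0, fun x _ => by rw [← b.sum_repr x]; simp⟩
  | succ n =>
    refine ⟨b.coord (Fin.last n), fun x hx => ?_⟩
    rw [← b.sum_repr x, Fin.sum_univ_castSucc]
    have hx' : b.repr x (Fin.last n) = 0 := hx
    rw [hx', zero_smul, add_zero]
    refine Submodule.sum_mem _ fun a _ => Submodule.smul_mem _ _ (Submodule.subset_span ⟨a, rfl⟩)

end Determinant

/-! ### Weight decomposition of the centralizer -/

section Grading

/-- The projections attached to an internal direct sum decomposition. -/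
theorem exists_projections {k A ι : Type*} [Field k] [AddCommGroup A] [Module k A]
    {W : ι → Submodule k A} (hind : iSupIndep W) (htop : ⨆ i, W i = ⊤) :
    ∃ π : ι → A →ₗ[k] A, (∀ i x, π i x ∈ W i) ∧ (∀ i, ∀ x ∈ W i, π i x = x) ∧
      (∀ i j, i ≠ j → ∀ x ∈ W j, π i x = 0) ∧ ∀ x, (∀ i, π i x = 0) → x = 0 := by
  classical
  have hint : DirectSum.IsInternal W :=
    (DirectSum.isInternal_submodule_iff_iSupIndep_and_iSup_eq_top W).2 ⟨hind, htop⟩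
  let : DirectSum.Decomposition W := hint.chooseDecomposition
  refine ⟨fun i => (W i).subtype ∘ₗ DirectSum.component k ι (fun i => W i) i ∘ₗ
    (DirectSum.decomposeLinearEquiv W).toLinearMap, fun i x => Subtype.mem _, fun i x hx => ?_,
    fun i j hij x hx => ?_, fun x hx => ?_⟩
  · exact DirectSum.decompose_of_mem_same W hx
  · exact DirectSum.decompose_of_mem_ne W hx (Ne.symm hij)
  · refine (DirectSum.decomposeLinearEquiv W).injective ?_
    rw [map_zero]
    refine DFinsupp.ext fun i => Subtype.ext (hx i)

theorem linearMap_ext_of_iSup_eq_top {k A B ι : Type*} [Field k] [AddCommGroup A] [Module k A]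
    [AddCommGroup B] [Module k B] {W : ι → Submodule k A} (htop : ⨆ i, W i = ⊤)
    {f g : A →ₗ[k] B} (h : ∀ i, ∀ x ∈ W i, f x = g x) : f = g := by
  have : (⊤ : Submodule k A) ≤ LinearMap.eqLocus f g := htop ▸ iSup_le fun i x hx => h i x hx
  exact LinearMap.ext fun x => this Submodule.mem_top

variable {k L : Type*} [Field k] [LieRing L] [LieAlgebra k L]

/-- The weight spaces of `t₁`, as subspaces of the Lie algebra `L^e`. -/
def gradedPiece (e : L) (t₁ : LieSubalgebra k L) (μ : Dual k t₁) :
    Submodule k (elementCentralizer k e) :=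
  (weightSpace e t₁ μ).comap (elementCentralizer k e).incl.toLinearMap

theorem mem_gradedPiece {e : L} {t₁ : LieSubalgebra k L} {μ : Dual k t₁}
    {x : elementCentralizer k e} :
    x ∈ gradedPiece e t₁ μ ↔ ∀ h : t₁, ⁅(h : L), (x : L)⁆ = μ h • (x : L) :=
  ⟨fun h => h.2, fun h => ⟨x.2, h⟩⟩

theorem lie_mem_gradedPiece {e : L} {t₁ : LieSubalgebra k L} {μ ν : Dual k t₁}
    {x y : elementCentralizer k e} (hx : x ∈ gradedPiece e t₁ μ) (hy : y ∈ gradedPiece e t₁ ν) :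
    ⁅x, y⁆ ∈ gradedPiece e t₁ (μ + ν) := by
  rw [mem_gradedPiece] at *
  intro h
  rw [LieSubalgebra.coe_bracket, leibniz_lie, hx, hy, smul_lie, lie_smul, LinearMap.add_apply,
    add_smul]

/-- The weight spaces for a torus in `L^e` form a direct sum decomposition of `L^e`. -/
theorem gradedPiece_isInternal [IsAlgClosed k] [FiniteDimensional k L] {e : L}
    {t₁ : LieSubalgebra k L} (ht₁ : IsTorus t₁) (ht₁e : t₁ ≤ elementCentralizer k e) :
    iSupIndep (gradedPiece e t₁) ∧ ⨆ μ, gradedPiece e t₁ μ = ⊤ := by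
  let A := elementCentralizer k e
  have hinv : ∀ h : t₁, A.toSubmodule ∈ (LieAlgebra.ad k L (h : L)).invtSubmodule :=
    fun h x hx => A.lie_mem (ht₁e h.2) hx
  let f : t₁ → End k A := fun h => (LieAlgebra.ad k L (h : L)).restrict (hinv h)
  have hss : ∀ h, (f h).IsSemisimple := fun h => (ht₁.semisimple h h.2).restrict (hinv h)
  have hcomm : ∀ h h', Commute (f h) (f h') := by
    intro h h'
    refine LinearMap.ext fun x => Subtype.ext ?_
    change ⁅(h : L), ⁅(h' : L), (x : L)⁆⁆ = ⁅(h' : L), ⁅(h : L), (x : L)⁆⁆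
    rw [leibniz_lie, ht₁.commutative h h.2 h' h'.2, zero_lie, zero_add]
  have hmaps : ∀ i j φ, Set.MapsTo (f i) ((f j).maxGenEigenspace φ) ((f j).maxGenEigenspace φ) :=
    fun i j φ => Module.End.mapsTo_maxGenEigenspace_of_comm (hcomm j i) φ
  have heig : ∀ h c, (f h).maxGenEigenspace c = (f h).eigenspace c := fun h c =>
    (hss h).isFinitelySemisimple.maxGenEigenspace_eq_eigenspace c
  have hmem : ∀ (χ : t₁ → k) (x : A), (x ∈ ⨅ i, (f i).maxGenEigenspace (χ i)) ↔
      ∀ h : t₁, ⁅(h : L), (x : L)⁆ = χ h • (x : L) := by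
    intro χ x
    simp only [Submodule.mem_iInf, heig, Module.End.mem_eigenspace_iff]
    exact forall_congr' fun h => Subtype.ext_iff
  constructor
  · have h1 := (Module.End.independent_iInf_maxGenEigenspace_of_forall_mapsTo f hmaps).comp
      (f := fun μ : Dual k t₁ => (μ : t₁ → k)) DFunLike.coe_injective
    refine h1.mono fun μ x hx => ?_
    exact (hmem _ x).2 (mem_gradedPiece.1 hx)
  · rw [eq_top_iff, ← Module.End.iSup_iInf_maxGenEigenspace_eq_top_of_forall_mapsTo f hmaps
      fun i => Module.End.iSup_maxGenEigenspace_eq_top (f i)]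
    refine iSup_le fun χ x hx => ?_
    rw [hmem] at hx
    by_cases hx0 : (x : L) = 0
    · rw [show x = 0 from Subtype.ext hx0]
      exact zero_mem _
    -- A function of eigenvalues with a nonzero simultaneous eigenvector is automatically linear.
    let μ : Dual k t₁ :=
      { toFun := χ
        map_add' := fun a b => by
          refine smul_left_injective k hx0 ?_
          change χ (a + b) • (x : L) = (χ a + χ b) • (x : L)
          rw [← hx, add_smul, ← hx, ← hx, ← add_lie]
          rfl
        map_smul' := fun c a => by
          refine smul_left_injective k hx0 ?_
          change χ (c • a) • (x : L) = (c * χ a) • (x : L)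
          rw [← hx, mul_smul, ← hx, ← smul_lie]
          rfl }
    exact Submodule.mem_iSup_of_mem μ (mem_gradedPiece.2 hx)

end Grading

/-! ### Splitting off the centralizer of the smaller torus -/

section Levi

variable {k L : Type*} [Field k] [LieRing L] [LieAlgebra k L]

/-- The sum of the weight spaces of `t₁` in `L^e` whose weight vanishes on `t`. -/
def leviPart (e : L) (t t₁ : LieSubalgebra k L) : Submodule k (elementCentralizer k e) :=
  ⨆ (μ : Dual k t₁) (_ : ∀ h : t₁, (h : L) ∈ t → μ h = 0), gradedPiece e t₁ μ

/-- The sum of the weight spaces of `t₁` in `L^e` whose weight does not vanish on `t`. -/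
def nilPart (e : L) (t t₁ : LieSubalgebra k L) : Submodule k (elementCentralizer k e) :=
  ⨆ (μ : Dual k t₁) (_ : ¬ ∀ h : t₁, (h : L) ∈ t → μ h = 0), gradedPiece e t₁ μ

variable {e : L} {t t₁ : LieSubalgebra k L}

theorem gradedPiece_le_leviPart {μ : Dual k t₁} (hμ : ∀ h : t₁, (h : L) ∈ t → μ h = 0) :
    gradedPiece e t₁ μ ≤ leviPart e t t₁ :=
  le_iSup₂_of_le μ hμ le_rfl

theorem gradedPiece_le_nilPart {μ : Dual k t₁} (hμ : ¬ ∀ h : t₁, (h : L) ∈ t → μ h = 0) :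
    gradedPiece e t₁ μ ≤ nilPart e t t₁ :=
  le_iSup₂_of_le μ hμ le_rfl

theorem leviPart_le {U : Submodule k (elementCentralizer k e)}
    (h : ∀ μ : Dual k t₁, (∀ h : t₁, (h : L) ∈ t → μ h = 0) → gradedPiece e t₁ μ ≤ U) :
    leviPart e t t₁ ≤ U :=
  iSup₂_le h

theorem nilPart_le {U : Submodule k (elementCentralizer k e)}
    (h : ∀ μ : Dual k t₁, (¬ ∀ h : t₁, (h : L) ∈ t → μ h = 0) → gradedPiece e t₁ μ ≤ U) :
    nilPart e t t₁ ≤ U :=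
  iSup₂_le h

theorem lie_mem_nilPart {x y : elementCentralizer k e} (hx : x ∈ leviPart e t t₁)
    (hy : y ∈ nilPart e t t₁) : ⁅x, y⁆ ∈ nilPart e t t₁ := by
  have h1 : ∀ μ : Dual k t₁, (¬ ∀ h : t₁, (h : L) ∈ t → μ h = 0) → ∀ z ∈ gradedPiece e t₁ μ,
      ⁅x, z⁆ ∈ nilPart e t t₁ := by
    intro μ hμ z hz
    have h2 : leviPart e t t₁ ≤ (nilPart e t t₁).comap (LieAlgebra.ad k _ z) := by
      refine leviPart_le fun ν hν w hw => ?_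
      have h3 : ⁅w, z⁆ ∈ nilPart e t t₁ := gradedPiece_le_nilPart (μ := ν + μ)
        (fun h0 => hμ fun h hh => by simpa [hν h hh] using h0 h hh) (lie_mem_gradedPiece hw hz)
      rw [Submodule.mem_comap, LieAlgebra.ad_apply, ← lie_skew]
      exact neg_mem h3
    rw [← lie_skew]
    exact neg_mem (h2 hx)
  exact nilPart_le (U := (nilPart e t t₁).comap (LieAlgebra.ad k _ x)) h1 hy

/-- Elements of `t` kill the weight spaces in `leviPart` and scale the others. Hence `t` stabilizes
every form vanishing on `nilPart`. -/
theorem lie_mem_nilPart_of_mem (ht₁e : t₁ ≤ elementCentralizer k e) (htop : ⨆ μ, gradedPiece e t₁ μ = ⊤)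
    {h : t₁} (hh : (h : L) ∈ t) (y : elementCentralizer k e) :
    ⁅(⟨h, ht₁e h.2⟩ : elementCentralizer k e), y⁆ ∈ nilPart e t t₁ := by
  have : ⊤ ≤ (nilPart e t t₁).comap
      (LieAlgebra.ad k _ (⟨h, ht₁e h.2⟩ : elementCentralizer k e)) := by
    rw [← htop]
    refine iSup_le fun μ x hx => ?_
    have hx' : ⁅(⟨h, ht₁e h.2⟩ : elementCentralizer k e), x⁆ = μ h • x :=
      Subtype.ext (mem_gradedPiece.1 hx h)
    rw [Submodule.mem_comap, LieAlgebra.ad_apply, hx']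
    by_cases hμ : ∀ h : t₁, (h : L) ∈ t → μ h = 0
    · simp [hμ h hh]
    · exact Submodule.smul_mem _ _ (gradedPiece_le_nilPart hμ hx)
  exact this Submodule.mem_top

theorem isCompl_leviPart_nilPart (hind : iSupIndep (gradedPiece e t₁))
    (htop : ⨆ μ, gradedPiece e t₁ μ = ⊤) : IsCompl (leviPart e t t₁) (nilPart e t t₁) := by
  obtain ⟨π, -, -, hne, hext⟩ := exists_projections hind htop
  refine IsCompl.of_eq ?_ ?_
  · refine (Submodule.eq_bot_iff _).2 fun x hx => hext x fun μ => ?_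
    by_cases hμ : ∀ h : t₁, (h : L) ∈ t → μ h = 0
    · exact nilPart_le (U := LinearMap.ker (π μ))
        (fun ν hν y hy => hne μ ν (by rintro rfl; exact hν hμ) y hy) hx.2
    · exact leviPart_le (U := LinearMap.ker (π μ))
        (fun ν hν y hy => hne μ ν (by rintro rfl; exact hμ hν) y hy) hx.1
  · rw [eq_top_iff, ← htop]
    refine iSup_le fun μ => ?_
    by_cases hμ : ∀ h : t₁, (h : L) ∈ t → μ h = 0
    · exact (gradedPiece_le_leviPart hμ).trans le_sup_left
    · exact (gradedPiece_le_nilPart hμ).trans le_sup_right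

theorem mem_leviCentralizer_of_mem_leviPart (htt₁ : t ≤ t₁) {x : elementCentralizer k e}
    (hx : x ∈ leviPart e t t₁) : (x : L) ∈ leviCentralizer e t := by
  have : leviPart e t t₁ ≤ (centralizer k (t : Set L)).toSubmodule.comap
      (elementCentralizer k e).incl.toLinearMap := by
    refine leviPart_le fun μ hμ y hy s hs => ?_
    have := mem_gradedPiece.1 hy ⟨s, htt₁ hs⟩
    rw [hμ _ hs, zero_smul] at this
    rw [← lie_skew, neg_eq_zero]
    exact this
  exact (LieSubalgebra.mem_inf _ _ _).2 ⟨this hx, x.2⟩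

theorem eq_zero_of_mem_nilPart (hind : iSupIndep (gradedPiece e t₁))
    (htop : ⨆ μ, gradedPiece e t₁ μ = ⊤) {x : elementCentralizer k e} (hx : x ∈ nilPart e t t₁)
    (hxt : ∀ h ∈ t, ⁅h, (x : L)⁆ = 0) (ht₁e : t₁ ≤ elementCentralizer k e) : x = 0 := by
  obtain ⟨π, hmem, heq, hne, hext⟩ := exists_projections hind htop
  refine hext x fun μ => ?_
  by_cases hμ : ∀ h : t₁, (h : L) ∈ t → μ h = 0
  · exact nilPart_le (U := LinearMap.ker (π μ))
      (fun ν hν y hy => hne μ ν (by rintro rfl; exact hν hμ) y hy) hx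
  · push Not at hμ
    obtain ⟨h, hh, hμh⟩ := hμ
    -- The projection `π μ` intertwines `ad h` with the scalar `μ h ≠ 0`, so a vector killed by `h`
    -- has no `μ`-component.
    have hlin : π μ ∘ₗ (LieAlgebra.ad k _ (⟨h, ht₁e h.2⟩ : elementCentralizer k e)) =
        μ h • π μ := by
      refine linearMap_ext_of_iSup_eq_top htop fun ν y hy => ?_
      have hy' : ⁅(⟨h, ht₁e h.2⟩ : elementCentralizer k e), y⁆ = ν h • y :=
        Subtype.ext (mem_gradedPiece.1 hy h)
      rw [LinearMap.comp_apply, LieAlgebra.ad_apply, hy', map_smul, LinearMap.smul_apply]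
      by_cases hμν : μ = ν
      · rw [hμν]
      · rw [hne μ ν hμν y hy, smul_zero, smul_zero]
    have h0 : ⁅(⟨h, ht₁e h.2⟩ : elementCentralizer k e), x⁆ = 0 := Subtype.ext (hxt h hh)
    have h1 := LinearMap.congr_fun hlin x
    rw [LinearMap.comp_apply, LieAlgebra.ad_apply, h0, map_zero, LinearMap.smul_apply] at h1
    exact (smul_eq_zero.1 h1.symm).resolve_left hμh

theorem mem_leviPart_of_mem_leviCentralizer (htt₁ : t ≤ t₁) (hind : iSupIndep (gradedPiece e t₁))
    (htop : ⨆ μ, gradedPiece e t₁ μ = ⊤) (ht₁e : t₁ ≤ elementCentralizer k e)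
    {x : elementCentralizer k e} (hx : (x : L) ∈ leviCentralizer e t) :
    x ∈ leviPart e t t₁ := by
  obtain ⟨y, hy, z, hz, rfl⟩ := Submodule.mem_sup.1
    ((isCompl_leviPart_nilPart (t := t) hind htop).sup_eq_top ▸ Submodule.mem_top (x := x))
  have hzl : (z : L) ∈ leviCentralizer e t := by
    have := sub_mem hx (mem_leviCentralizer_of_mem_leviPart htt₁ hy)
    simpa using this
  have hz0 : z = 0 := by
    refine eq_zero_of_mem_nilPart hind htop hz (fun h hh => ?_) ht₁e
    rw [← lie_skew, ((LieSubalgebra.mem_inf _ _ _).1 hzl).1 h hh, neg_zero]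
  rwa [hz0, add_zero]

/-- The projection of `L^e` onto `𝔩^e` along the remaining weight spaces. -/
theorem exists_projection_leviCentralizer (htt₁ : t ≤ t₁) (hind : iSupIndep (gradedPiece e t₁))
    (htop : ⨆ μ, gradedPiece e t₁ μ = ⊤) (ht₁e : t₁ ≤ elementCentralizer k e) :
    ∃ ψ : elementCentralizer k e →ₗ[k] leviCentralizer e t, (∀ x ∈ nilPart e t t₁, ψ x = 0) ∧
      ∀ (x : elementCentralizer k e) (hx : (x : L) ∈ leviCentralizer e t), ψ x = ⟨x, hx⟩ := by
  have hc := isCompl_leviPart_nilPart (t := t) hind htop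
  let j : leviPart e t t₁ →ₗ[k] leviCentralizer e t :=
    ((elementCentralizer k e).incl.toLinearMap ∘ₗ (leviPart e t t₁).subtype).codRestrict
      (leviCentralizer e t).toSubmodule
      fun x => mem_leviCentralizer_of_mem_leviPart htt₁ x.2
  refine ⟨j ∘ₗ Submodule.projectionOnto _ _ hc, fun x hx => ?_, fun x hx => ?_⟩
  · rw [LinearMap.comp_apply, Submodule.projectionOnto_apply_of_mem_right hc hx, map_zero]
  · have := Submodule.projectionOnto_apply_left hc
      ⟨x, mem_leviPart_of_mem_leviCentralizer htt₁ hind htop ht₁e hx⟩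
    rw [LinearMap.comp_apply]
    erw [this]
    rfl

end Levi

/-! ### Generic forms and the upper bound -/

section Generic

variable {k L : Type*} [Field k] [LieRing L] [LieAlgebra k L]

theorem finrank_ker_kirillovFormOn_le_two {A : Type*} [LieRing A] [LieAlgebra k A]
    {V : Submodule k A} {ξ : Dual k A} (α β : Dual k A)
    (h : ∀ x ∈ V, (∀ y ∈ V, ξ ⁅x, y⁆ = 0) → α x = 0 → β x = 0 → x = 0) :
    finrank k (LinearMap.ker (kirillovFormOn V ξ)) ≤ 2 := by
  let θ : LinearMap.ker (kirillovFormOn V ξ) →ₗ[k] k × k :=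
    (α.prod β) ∘ₗ V.subtype ∘ₗ Submodule.subtype _
  have hθ : Function.Injective θ := by
    rw [← LinearMap.ker_eq_bot, LinearMap.ker_eq_bot']
    rintro ⟨⟨x, hx⟩, hxk⟩ h0
    have h0' : α x = 0 ∧ β x = 0 := by simpa [θ] using h0
    have := h x hx (fun y hy => LinearMap.congr_fun hxk ⟨y, hy⟩) h0'.1 h0'.2
    simpa using this
  simpa using LinearMap.finrank_le_finrank_of_injective hθ

variable {e : L} {t t₁ : LieSubalgebra k L}

/-- The pairing of opposite weight spaces defined by a linear form on `𝔩^e`. -/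
def oppositePairing (htt₁ : t ≤ t₁) (ζ : Dual k (leviCentralizer e t)) (μ : Dual k t₁) :
    weightSpace e t₁ μ →ₗ[k] weightSpace e t₁ (-μ) →ₗ[k] k :=
  LinearMap.mk₂ k (fun x y => ζ (oppositeBracket htt₁ x y))
    (fun x x' y => by
      rw [← map_add]
      exact congrArg ζ (Subtype.ext (add_lie (x : L) (x' : L) (y : L))))
    (fun c x y => by
      rw [← map_smul]
      exact congrArg ζ (Subtype.ext (smul_lie c (x : L) (y : L))))
    (fun x y y' => by
      rw [← map_add]
      exact congrArg ζ (Subtype.ext (lie_add (x : L) (y : L) (y' : L))))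
    (fun c x y => by
      rw [← map_smul]
      exact congrArg ζ (Subtype.ext (lie_smul c (x : L) (y : L))))

theorem lift_bracketDet (htt₁ : t ≤ t₁) (ζ : Dual k (leviCentralizer e t)) {μ : Dual k t₁} {n : ℕ}
    (v : Fin n → weightSpace e t₁ μ) (w : Fin n → weightSpace e t₁ (-μ)) :
    SymmetricAlgebra.lift ζ (bracketDet htt₁ v w) =
      (Matrix.of fun a b => oppositePairing htt₁ ζ μ (v a) (w b)).det := by
  rw [bracketDet, AlgHom.map_det]
  congr 1
  ext a b
  simp [oppositePairing]

/-- A linear form on `𝔩^e` at which all relevant determinants are nonzero. -/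
theorem exists_generic_form [Infinite k] [FiniteDimensional k L] (htt₁ : t ≤ t₁)
    {m : ℕ} {χ : Fin m → Dual k t₁} {r : Fin m → ℕ}
    (v : ∀ i, Basis (Fin (r i)) k (weightSpace e t₁ (χ i)))
    (w : ∀ i, Basis (Fin (r i)) k (weightSpace e t₁ (-χ i)))
    (hq : (∀ i, bracketDet htt₁ (v i) (w i) ≠ 0) ∨
      ∃ j, (∀ i, i ≠ j → bracketDet htt₁ (v i) (w i) ≠ 0) ∧
        ∃ (v' : Basis (Fin (r j)) k (weightSpace e t₁ (χ j)))
          (w' : Basis (Fin (r j)) k (weightSpace e t₁ (-χ j))),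
          bracketDet htt₁
            (fun a : Fin (r j - 1) => v' (Fin.castLE (Nat.sub_le _ _) a))
            (fun a : Fin (r j - 1) => w' (Fin.castLE (Nat.sub_le _ _) a)) ≠ 0)
    {A : Type*} [AddCommGroup A] [Module k A] (c : ∀ μ, A →ₗ[k] weightSpace e t₁ μ) :
    ∃ (ζ : Dual k (leviCentralizer e t)) (α β : Dual k A), ∀ x, α x = 0 → β x = 0 → ∀ i,
      ∃ (n : ℕ) (v' : Fin n → weightSpace e t₁ (χ i)) (w' : Fin n → weightSpace e t₁ (-χ i)),
        (Matrix.of fun a b => oppositePairing htt₁ ζ (χ i) (v' a) (w' b)).det ≠ 0 ∧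
        c (χ i) x ∈ Submodule.span k (Set.range v') ∧
        c (-χ i) x ∈ Submodule.span k (Set.range w') := by
  classical
  simp only [← lift_bracketDet]
  rcases hq with hq | ⟨j, hq, v', w', hq'⟩
  -- The symmetric algebra is a domain, so the product of the determinants is nonzero and one `ζ`
  -- serves for all `i`.
  · obtain ⟨ζ, hζ⟩ := exists_lift_ne_zero (Finset.prod_ne_zero_iff.2 fun i (_ : i ∈ Finset.univ) => hq i)
    rw [map_prod, Finset.prod_ne_zero_iff] at hζ
    refine ⟨ζ, 0, 0, fun x _ _ i => ⟨r i, v i, w i, hζ i (Finset.mem_univ i), ?_, ?_⟩⟩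
    · rw [(v i).span_eq]; trivial
    · rw [(w i).span_eq]; trivial
  · obtain ⟨ζ, hζ⟩ := exists_lift_ne_zero (mul_ne_zero (Finset.prod_ne_zero_iff.2
      fun i (hi : i ∈ Finset.univ.erase j) => hq i (Finset.ne_of_mem_erase hi)) hq')
    rw [map_mul, map_prod, mul_ne_zero_iff, Finset.prod_ne_zero_iff] at hζ
    obtain ⟨α, hα⟩ := exists_dual_mem_span_castLE v'
    obtain ⟨β, hβ⟩ := exists_dual_mem_span_castLE w'
    -- The two forms force the `±χ j` components into the spans on which the smaller minor is
    -- nondegenerate; this is the source of the defect 2.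
    refine ⟨ζ, α ∘ₗ c (χ j), β ∘ₗ c (-χ j), fun x hx hx' i => ?_⟩
    by_cases hij : i = j
    · subst hij
      exact ⟨_, _, _, hζ.2, hα _ hx, hβ _ hx'⟩
    · refine ⟨r i, v i, w i, hζ.1 i (by simp [hij]), ?_, ?_⟩
      · rw [(v i).span_eq]; trivial
      · rw [(w i).span_eq]; trivial

theorem index_elementCentralizer_le [IsAlgClosed k] [FiniteDimensional k L]
    (htt₁ : t ≤ t₁) (ht₁ : IsTorus t₁) (ht₁e : t₁ ≤ elementCentralizer k e)
    {m : ℕ} {χ : Fin m → Dual k t₁}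
    (hweights : ∀ μ : Dual k t₁, IsWeightNonzeroOn e t t₁ μ → ∃ i, μ = χ i ∨ μ = -χ i)
    {r : Fin m → ℕ}
    (v : ∀ i, Basis (Fin (r i)) k (weightSpace e t₁ (χ i)))
    (w : ∀ i, Basis (Fin (r i)) k (weightSpace e t₁ (-χ i)))
    (hq : (∀ i, bracketDet htt₁ (v i) (w i) ≠ 0) ∨
      ∃ j, (∀ i, i ≠ j → bracketDet htt₁ (v i) (w i) ≠ 0) ∧
        ∃ (v' : Basis (Fin (r j)) k (weightSpace e t₁ (χ j)))
          (w' : Basis (Fin (r j)) k (weightSpace e t₁ (-χ j))),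
          bracketDet htt₁
            (fun a : Fin (r j - 1) => v' (Fin.castLE (Nat.sub_le _ _) a))
            (fun a : Fin (r j - 1) => w' (Fin.castLE (Nat.sub_le _ _) a)) ≠ 0) :
    index k (elementCentralizer k e) ≤ index k (leviCentralizer e t) := by
  obtain ⟨hind, htop⟩ := gradedPiece_isInternal ht₁ ht₁e
  obtain ⟨π, hmem, heq, hne, hext⟩ := exists_projections hind htop
  obtain ⟨ψ, hψV, hψ⟩ := exists_projection_leviCentralizer htt₁ hind htop ht₁e
  have hinf : Infinite k := IsAlgClosed.instInfinite
  let c : ∀ μ, elementCentralizer k e →ₗ[k] weightSpace e t₁ μ := fun μ =>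
    ((elementCentralizer k e).incl.toLinearMap ∘ₗ π μ).codRestrict _ (hmem μ)
  obtain ⟨ζ₁, α, β, hζ₁⟩ := exists_generic_form htt₁ v w hq c
  obtain ⟨ζ₂, hζ₂⟩ := Nat.sInf_mem (Set.range_nonempty
    fun ξ : Dual k (leviCentralizer e t) => finrank k (coadjointStabilizer k ξ))
  -- Composing with `π 0` kills the nonzero `t₁`-weights inside `𝔩^e` as well, so `ξ₁` pairs a
  -- weight space only with its opposite.
  let ξ₁ : Dual k (elementCentralizer k e) := ζ₁ ∘ₗ ψ ∘ₗ π 0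
  have hnil : ∀ μ : Dual k t₁, (∀ h : t₁, (h : L) ∈ t → μ h = 0) → ∀ x ∈ nilPart e t t₁,
      π μ x = 0 := fun μ hμ x hx => nilPart_le (U := LinearMap.ker (π μ))
    (fun ν hν y hy => hne μ ν (by rintro rfl; exact hν hμ) y hy) hx
  have hpair : ∀ {μ : Dual k t₁} {x y : elementCentralizer k e} (hx : x ∈ gradedPiece e t₁ μ)
      (hy : y ∈ gradedPiece e t₁ (-μ)),
      ξ₁ ⁅x, y⁆ = oppositePairing htt₁ ζ₁ μ ⟨x, hx⟩ ⟨y, hy⟩ := by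
    intro μ x y hx hy
    have h0 : ⁅x, y⁆ ∈ gradedPiece e t₁ 0 := by
      have := lie_mem_gradedPiece hx hy
      rwa [add_neg_cancel] at this
    change ζ₁ (ψ (π 0 ⁅x, y⁆)) = ζ₁ _
    rw [heq 0 _ h0, hψ ⁅x, y⁆ (lie_mem_leviCentralizer htt₁ hx hy)]
    rfl
  have hcomp : ∀ (μ : Dual k t₁) (x y : elementCentralizer k e), y ∈ gradedPiece e t₁ (-μ) →
      ξ₁ ⁅π μ x, y⁆ = ξ₁ ⁅x, y⁆ := by
    intro μ x y hy
    have : ξ₁ ∘ₗ (LieAlgebra.ad k (elementCentralizer k e) y) ∘ₗ π μ =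
        ξ₁ ∘ₗ (LieAlgebra.ad k (elementCentralizer k e) y) := by
      refine linearMap_ext_of_iSup_eq_top htop fun ν z hz => ?_
      simp only [LinearMap.comp_apply, LieAlgebra.ad_apply]
      by_cases hμν : μ = ν
      · subst hμν
        rw [heq _ _ hz]
      · rw [hne μ ν hμν z hz, lie_zero, map_zero]
        have h1 := lie_mem_gradedPiece hy hz
        change _ = ζ₁ (ψ (π 0 ⁅y, z⁆))
        rw [hne 0 (-μ + ν) (fun h0 => hμν (by rwa [eq_comm, neg_add_eq_zero] at h0)) _ h1, map_zero,
          map_zero]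
    have h2 := LinearMap.congr_fun this x
    simp only [LinearMap.comp_apply, LieAlgebra.ad_apply] at h2
    rw [← lie_skew, map_neg, h2, ← map_neg, lie_skew]
  refine index_le_of_isCompl (isCompl_leviPart_nilPart (t := t) hind htop)
    (fun x hx y hy => lie_mem_nilPart hx hy) (fun a ha ha0 => ?_) (ξ₁ := ξ₁) (ξ₂ := ζ₂ ∘ₗ ψ)
    (fun x hx => ?_) (fun x hx => ?_) ?_ ?_
  -- An element of `V` commuting with all of `t` is zero, so some `h ∈ t` moves `a`.
  · by_contra! hcon
    refine ha0 (eq_zero_of_mem_nilPart hind htop ha (fun h hh => ?_) ht₁e)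
    exact congrArg Subtype.val (hcon ⟨h, ht₁e (htt₁ hh)⟩
      fun y => lie_mem_nilPart_of_mem ht₁e htop (h := ⟨h, htt₁ hh⟩) hh y)
  · change ζ₁ (ψ (π 0 x)) = 0
    rw [hnil 0 (fun _ _ => rfl) x hx, map_zero, map_zero]
  · rw [LinearMap.comp_apply, hψV x hx, map_zero]
  -- On `leviPart` the map `ψ` is the identification with `𝔩^e`; it embeds the kernel into the
  -- stabilizer of `ζ₂`, which attains the index.
  · refine le_of_le_of_eq ?_ hζ₂
    let j : LinearMap.ker (kirillovFormOn (leviPart e t t₁) (ζ₂ ∘ₗ ψ)) →ₗ[k]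
        coadjointStabilizer k ζ₂ :=
      (ψ ∘ₗ (leviPart e t t₁).subtype ∘ₗ Submodule.subtype _).codRestrict _ fun x => by
        refine mem_coadjointStabilizer.2 fun y => ?_
        have hy : (y : L) ∈ elementCentralizer k e := ((LieSubalgebra.mem_inf _ _ _).1 y.2).2
        have h1 := LinearMap.congr_fun x.2 ⟨⟨y, hy⟩,
          mem_leviPart_of_mem_leviCentralizer htt₁ hind htop ht₁e y.2⟩
        have hx := mem_leviCentralizer_of_mem_leviPart htt₁ x.1.2
        simp only [kirillovFormOn_apply, LinearMap.comp_apply, LinearMap.zero_apply] at h1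
        rw [hψ _ ((leviCentralizer e t).lie_mem hx y.2)] at h1
        simp only [LinearMap.comp_apply, Submodule.subtype_apply]
        rw [hψ _ hx]
        exact h1
    refine LinearMap.finrank_le_finrank_of_injective (f := j) ?_
    rw [← LinearMap.ker_eq_bot, LinearMap.ker_eq_bot']
    intro x hx
    have h1 : ψ (x.1 : elementCentralizer k e) = 0 := congrArg Subtype.val hx
    rw [hψ _ (mem_leviCentralizer_of_mem_leviPart htt₁ x.1.2)] at h1
    have h2 : ((x.1 : elementCentralizer k e) : L) = 0 := congrArg Subtype.val h1
    exact Subtype.ext (Subtype.ext (Subtype.ext h2))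
  · refine finrank_ker_kirillovFormOn_le_two α β fun x hx hker hα hβ => hext x fun μ => ?_
    by_cases hμ : ∀ h : t₁, (h : L) ∈ t → μ h = 0
    · exact hnil μ hμ x hx
    by_contra hne0
    have hwt : IsWeightNonzeroOn e t t₁ μ := by
      refine ⟨fun hbot => hne0 ?_, by push Not at hμ; exact hμ⟩
      have := hmem μ x
      rw [gradedPiece, hbot] at this
      exact Subtype.ext this
    have hcne0 : c μ x ≠ 0 := fun h0 => by
      have h1 : ((π μ x : elementCentralizer k e) : L) = 0 := congrArg Subtype.val h0
      exact hne0 (Subtype.ext h1)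
    have hneg : ∀ {ν : Dual k t₁}, (¬ ∀ h : t₁, (h : L) ∈ t → ν h = 0) →
        ¬ ∀ h : t₁, (h : L) ∈ t → (-ν) h = 0 := fun hν h0 => hν fun h hh => by
      simpa using h0 h hh
    -- The weight is `χ i` or `-χ i`, and its component of `x` is orthogonal to the opposite weight
    -- space; it vanishes by nondegeneracy in the left or the right variable respectively.
    obtain ⟨i, hi⟩ := hweights μ hwt
    obtain ⟨n, v', w', hdet, hv, hw⟩ := hζ₁ x hα hβ i
    rcases hi with rfl | rfl
    · refine hcne0 (eq_zero_of_det_ne_zero_left _ hdet hv fun b => ?_)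
      let y : elementCentralizer k e := ⟨w' b, (w' b).2.1⟩
      have hy : y ∈ gradedPiece e t₁ (-χ i) := (w' b).2
      have h1 := hpair (hmem (χ i) x) hy
      rw [hcomp _ _ _ hy, hker y (gradedPiece_le_nilPart (hneg hμ) hy)] at h1
      exact h1.symm
    · refine hcne0 (eq_zero_of_det_ne_zero_right _ hdet hw fun a => ?_)
      let y : elementCentralizer k e := ⟨v' a, (v' a).2.1⟩
      have hy : y ∈ gradedPiece e t₁ (χ i) := (v' a).2
      have hy' : y ∈ gradedPiece e t₁ (-(-χ i)) := by rwa [neg_neg]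
      have h1 := hpair hy (hmem (-χ i) x)
      have h2 := hker y (gradedPiece_le_nilPart (hneg hμ) hy')
      rw [← hcomp _ _ _ hy', ← lie_skew, map_neg, neg_eq_zero] at h2
      rw [h2] at h1
      exact h1.symm

end Generic

end LieIndex

theorem proposition6p7 {k L : Type*} [Field k] [IsAlgClosed k] [CharZero k]
    [LieRing L] [LieAlgebra k L] [FiniteDimensional k L] [LieAlgebra.IsSemisimple k L]
    (e : L) (he : IsNilpotent (LieAlgebra.ad k L e))
    (t t₁ : LieSubalgebra k L) (htt₁ : t ≤ t₁)
    (ht : LieIndex.IsTorus t) (ht₁ : LieIndex.IsTorus t₁)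
    (ht₁e : t₁ ≤ LieIndex.elementCentralizer k e)
    (m : ℕ) (χ : Fin m → Module.Dual k t₁) (hχ : Function.Injective χ)
    (hweights : ∀ μ : Module.Dual k t₁,
      LieIndex.IsWeightNonzeroOn e t t₁ μ ↔ ∃ i, μ = χ i ∨ μ = -χ i)
    (r : Fin m → ℕ)
    (v : ∀ i, Module.Basis (Fin (r i)) k (LieIndex.weightSpace e t₁ (χ i)))
    (w : ∀ i, Module.Basis (Fin (r i)) k (LieIndex.weightSpace e t₁ (-χ i)))
    (hl : LieIndex.index k (LieIndex.leviCentralizer e t) = LieAlgebra.rank k L)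
    (hq : (∀ i, LieIndex.bracketDet htt₁ (v i) (w i) ≠ 0) ∨
      ∃ j, (∀ i, i ≠ j → LieIndex.bracketDet htt₁ (v i) (w i) ≠ 0) ∧
        ∃ (v' : Module.Basis (Fin (r j)) k (LieIndex.weightSpace e t₁ (χ j)))
          (w' : Module.Basis (Fin (r j)) k (LieIndex.weightSpace e t₁ (-χ j))),
          LieIndex.bracketDet htt₁
            (fun a : Fin (r j - 1) => v' (Fin.castLE (Nat.sub_le _ _) a))
            (fun a : Fin (r j - 1) => w' (Fin.castLE (Nat.sub_le _ _) a)) ≠ 0) :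
    LieIndex.index k (LieIndex.elementCentralizer k e) = LieAlgebra.rank k L := by
  exact le_antisymm ((LieIndex.index_elementCentralizer_le htt₁ ht₁ ht₁e
    (fun μ => (hweights μ).1) v w hq).trans hl.le) (LieIndex.rank_le_index_elementCentralizer e)
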